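/- Let $k\ge 1$ be an integer, $\varrho\in(0,1]$ and $\varepsilon\in(0,1/4]$. A channel $W\colon[2k]\to\{0,1\}^\ast$ assigns to each $x\in[2k]$ a probability distribution $W(\cdot\mid x)$ on $\{0,1\}^\ast$. It is $\varrho$-locally differentially private if $W(y\mid x_1)\le e^{\varrho}\,W(y\mid x_2)$ for all $x_1,x_2\in[2k]$ and $y\in\{0,1\}^\ast$; let $\mathcal{W}_\varrho$ be the set of all such channels. In an $n$-user sequentially interactive protocol using $\mathcal{W}_\varrho$, user $t$ holds $X_t$, where $X_1,\dots,X_n$ are i.i.d. with distribution $p$ on $[2k]$; a public random variable $U$, with values in an arbitrary probability space, is independent of $(X_1,\dots,X_n)$; for $t=1,\dots,n$, user $t$ selects a channel $W_t\in\mathcal{W}_\varrho$ as a function of $(Y_1,\dots,Y_{t-1},U)$ and sends $Y_t$ drawn from $W_t(\cdot\mid X_t)$. An $(n,\varepsilon)$-estimator using $\mathcal{W}_\varrho$ is such a protocol together with a map $\hat p$ from transcripts $(Y_1,\dots,Y_n,U)$ to distributions on $[2k]$ such that $$\sup_{p}\ \Pr_{X^n\sim p^n}\bigl[d_{\mathrm{TV}}(\hat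 p(Y^n,U),p)>\varepsilon\bigr]\le \tfrac1{100},$$ the supremum being over all distributions $p$ on $[2k]$, where $d_{\mathrm{TV}}(p,q)=\sup_{S\subseteq[2k]}(p(S)-q(S))$. The sample complexity of interactive $(2k,\varepsilon)$-distribution learning under $\varrho$-LDP channels is the least $n$ for which an $(n,\varepsilon)$-estimator using $\mathcal{W}_\varrho$ exists ($+\infty$ if there is none). There is an absolute constant $c>0$ such that, for all such $k,\varepsilon,\varrho$, this sample complexity is at least $$c\,\frac{k^2}{\varepsilon^2\varrho^2}.$$ -/

import Mathlib

open MeasureTheory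
open scoped ENNReal

universe u

noncomputable section

namespace LocalInference

/-- Total variation distance between two distributions on a finite domain,
`sup_{S ⊆ X} (p(S) - q(S))`. -/
def tvDist {X : Type*} [Fintype X] (p q : PMF X) : ℝ :=
  ⨆ S : Finset X, ∑ x ∈ S, ((p x).toReal - (q x).toReal)

/-- A channel from the domain `[2k]` to the message space `Y`: `W x y` is `W(y ∣ x)`. -/
abbrev Channel (k : ℕ) (Y : Type*) := Fin (2 * k) → PMF Y

/-- The `ρ`-locally differentially private channels, with messages in `{0,1}^*`.
The ratio bound is written multiplicatively, so that it is meaningful when `W(y ∣ x₂) = 0`. -/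
def ldpChannels (k : ℕ) (ρ : ℝ) : Set (Channel k (List Bool)) :=
  {W | ∀ (x₁ x₂ : Fin (2 * k)) (y : List Bool),
    W x₁ y ≤ ENNReal.ofReal (Real.exp ρ) * W x₂ y}

/-- A sequentially interactive protocol for `n` users under the local constraints `𝒲`, with
public randomness in `Ω`: user `t` chooses a channel in `𝒲` as a (measurable) function of the
previous messages and of the public randomness. -/
structure InteractiveProtocol {k : ℕ} {Y : Type*} [Countable Y] (𝒲 : Set (Channel k Y))
    (n : ℕ) (Ω : Type u) [MeasurableSpace Ω] where
  channel : (t : Fin n) → (Fin t → Y) → Ω → Channel k Y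
  channel_mem : ∀ t h ω, channel t h ω ∈ 𝒲
  measurable_channel : ∀ t h x y, Measurable fun ω => channel t h ω x y

namespace InteractiveProtocol

variable {k : ℕ} {Y : Type*} [Countable Y] {𝒲 : Set (Channel k Y)} {n : ℕ} {Ω : Type u}
  [MeasurableSpace Ω]

/-- Law of the first `t` messages, given the public randomness `ω`, when the users hold
independent samples from `p`: after the messages `h` of the first `t` users, the next user draws a
fresh sample `x` from `p` and sends `y` drawn from the chosen channel at input `x`. -/
def messageLaw (P : InteractiveProtocol 𝒲 n Ω) (p : PMF (Fin (2 * k))) (ω : Ω) :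
    (t : ℕ) → t ≤ n → PMF (Fin t → Y)
  | 0, _ => PMF.pure Fin.elim0
  | t + 1, ht =>
      (P.messageLaw p ω t (Nat.le_of_succ_le ht)).bind fun h =>
        p.bind fun x =>
          (P.channel ⟨t, ht⟩ h ω x).bind fun y =>
            PMF.pure (Fin.snoc (α := fun _ => Y) h y)

/-- Probability that the estimate computed from the transcript (all `n` messages and the public
randomness, of law `μ`) is at total variation distance more than `ε` from the truth `p`. -/
def errorProb (P : InteractiveProtocol 𝒲 n Ω) (μ : Measure Ω)
    (est : (Fin n → Y) → Ω → PMF (Fin (2 * k))) (ε : ℝ) (p : PMF (Fin (2 * k))) : ℝ≥0∞ :=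
  ∫⁻ ω, (P.messageLaw p ω n le_rfl).toOuterMeasure {y | ε < tvDist (est y ω) p} ∂μ

end InteractiveProtocol

/-- There is an `(n, ε)`-estimator using `𝒲`: an `n`-user interactive protocol and an estimator
that, for every distribution on `[2k]`, errs by more than `ε` with probability at most `1/100`. -/
def HasEstimator {k : ℕ} {Y : Type*} [Countable Y] (𝒲 : Set (Channel k Y)) (ε : ℝ) (n : ℕ) :
    Prop :=
  ∃ (Ω : Type u) (_ : MeasurableSpace Ω) (μ : Measure Ω) (_ : IsProbabilityMeasure μ)
    (P : InteractiveProtocol 𝒲 n Ω) (est : (Fin n → Y) → Ω → PMF (Fin (2 * k))),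
    (∀ y x, Measurable fun ω => est y ω x) ∧
      ⨆ p : PMF (Fin (2 * k)), P.errorProb μ est ε p ≤ 1 / 100

/-- Sample complexity of interactive `(2k, ε)`-distribution learning using `𝒲`: the least `n`
such that there is an `(n, ε)`-estimator using `𝒲` (and `⊤` if there is none). -/
def learningSampleComplexity {k : ℕ} {Y : Type*} [Countable Y] (𝒲 : Set (Channel k Y)) (ε : ℝ) :
    ℕ∞ :=
  ⨅ (n : ℕ) (_ : HasEstimator.{u} 𝒲 ε n), (n : ℕ∞)

end LocalInference

end

open MeasureTheory
open scoped ENNReal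

namespace LocalInference

/-! ### Total variation distance and Hellinger affinity -/

/-! This is Assouad's method over the `2 ^ k` distributions `perturbed`, with `γ = 4 * ε`. Flipping
one sign moves such a distribution by `2γ/k` in `ℓ¹`. Privacy shrinks this further: under any
allowed channel the two output laws differ pointwise by a relative factor of at most `δ =
(2γ/k)(2ρ)` (`abs_bind_sub_bind_le`).

A relative change `δ` costs at most `δ²/2` of Hellinger affinity, and the affinity factors along the
message history. Adaptive choice of channels therefore costs nothing extra: `n` messages lose at
most `nδ²/2` (`one_le_affinity_messageLaw_add`).

Conversely, an estimate within `ε` correlates with the hidden signs (`half_le_sum_signEstimate`). A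
successful estimator thus forces some flip to change the transcript law by at least `97/100` in `ℓ¹`
(`le_of_signs_estimated`). Hence `nδ²` is bounded below by a constant. -/

theorem half_sum_abs_sub_le_tvDist {X : Type*} [Fintype X] (p q : PMF X) :
    (∑ x, |(p x).toReal - (q x).toReal|) / 2 ≤ tvDist p q := by
  classical
  have hbdd : BddAbove (Set.range fun S : Finset X => ∑ x ∈ S, ((p x).toReal - (q x).toReal)) :=
    Set.Finite.bddAbove (Set.finite_range _)
  have hsum (r : PMF X) : ∑ x, (r x).toReal = 1 := by
    rw [← ENNReal.toReal_sum fun x _ => r.apply_ne_top x, ← tsum_fintype (L := .unconditional X),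
      r.tsum_coe, ENNReal.toReal_one]
  have hzero : ∑ x, ((p x).toReal - (q x).toReal) = 0 := by
    rw [Finset.sum_sub_distrib, hsum, hsum, sub_self]
  -- The differences sum to zero, so the positive ones carry half of the `ℓ¹` norm; their support is
  -- the test set.
  have habs : ∑ x, |(p x).toReal - (q x).toReal| =
      2 * ∑ x with 0 ≤ (p x).toReal - (q x).toReal, ((p x).toReal - (q x).toReal) := by
    rw [Finset.sum_filter, Finset.mul_sum]
    have : ∑ x, |(p x).toReal - (q x).toReal| = ∑ x, |(p x).toReal - (q x).toReal| +
        ∑ x, ((p x).toReal - (q x).toReal) := by rw [hzero, add_zero]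
    rw [this, ← Finset.sum_add_distrib]
    refine Finset.sum_congr rfl fun x _ => ?_
    split_ifs with h
    · rw [abs_of_nonneg h]; ring
    · rw [abs_of_neg (not_le.mp h)]; ring
  rw [habs, mul_div_cancel_left₀ _ two_ne_zero]
  exact le_ciSup hbdd _

/-- The Hellinger affinity `∑ √(p q)` of two distributions. -/
noncomputable def affinity {A : Type*} (p q : PMF A) : ℝ≥0∞ :=
  ∑' a, ENNReal.ofReal √((p a).toReal * (q a).toReal)

theorem affinity_le_one {A : Type*} (p q : PMF A) : affinity p q ≤ 1 := by
  have h : affinity p q ≤ ∑' a, (p a + q a) / 2 := by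
    refine ENNReal.tsum_le_tsum fun a => ?_
    have : (p a + q a) / 2 = ENNReal.ofReal (((p a).toReal + (q a).toReal) / 2) := by
      rw [ENNReal.ofReal_div_of_pos two_pos, ENNReal.ofReal_add (by positivity) (by positivity),
        ENNReal.ofReal_toReal (p.apply_ne_top a), ENNReal.ofReal_toReal (q.apply_ne_top a)]
      simp
    rw [this]
    refine ENNReal.ofReal_le_ofReal (Real.sqrt_le_iff.mpr ⟨by positivity, ?_⟩)
    nlinarith [sq_nonneg ((p a).toReal - (q a).toReal)]
  refine h.trans (le_of_eq ?_)
  simp_rw [div_eq_mul_inv]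
  rw [ENNReal.tsum_mul_right, ENNReal.tsum_add, p.tsum_coe, q.tsum_coe, one_add_one_eq_two,
    ENNReal.mul_inv_cancel two_ne_zero ENNReal.ofNat_ne_top]

/-- The gap between the two means is `(√a - √b)² / 2`, and `√a |√a - √b| ≤ |a - b|`. The loss is
thus quadratic in `δ`, which gives the squares in the final bound. -/
theorem half_add_le_sqrt_mul_add {a b δ : ℝ} (ha : 0 ≤ a) (hb : 0 ≤ b)
    (h : |a - b| ≤ δ * a) : (a + b) / 2 ≤ √(a * b) + δ ^ 2 / 2 * a := by
  rcases ha.eq_or_lt with rfl | ha'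
  · have : b = 0 := by simpa using h
    simp [this]
  have hsq : (a - b) ^ 2 ≤ (δ * a) ^ 2 := sq_le_sq' (by linarith [(abs_le.mp h).1]) (abs_le.mp h).2
  rw [Real.sqrt_mul ha]
  have hA := Real.sq_sqrt ha
  have hB := Real.sq_sqrt hb
  set s := √a
  set r := √b
  have hs : 0 < s := Real.sqrt_pos.mpr ha'
  have hr : 0 ≤ r := Real.sqrt_nonneg b
  have key : (s - r) ^ 2 ≤ δ ^ 2 * s ^ 2 := by
    refine le_of_mul_le_mul_right ?_ (pow_pos hs 2)
    calc (s - r) ^ 2 * s ^ 2 ≤ (s - r) ^ 2 * (s + r) ^ 2 := by gcongr; linarith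
      _ = (a - b) ^ 2 := by rw [← hA, ← hB]; ring
      _ ≤ δ ^ 2 * s ^ 2 * s ^ 2 := by rw [← hA] at hsq ⊢; linarith
  rw [← hA, ← hB]
  linarith

theorem one_le_affinity_add {A : Type*} (p q : PMF A) (δ : ℝ)
    (h : ∀ a, |(p a).toReal - (q a).toReal| ≤ δ * (p a).toReal) :
    1 ≤ affinity p q + ENNReal.ofReal (δ ^ 2 / 2) := by
  calc (1 : ℝ≥0∞) = ∑' a, (p a + q a) / 2 := by
        simp_rw [div_eq_mul_inv]
        rw [ENNReal.tsum_mul_right, ENNReal.tsum_add, p.tsum_coe, q.tsum_coe, one_add_one_eq_two,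
          ENNReal.mul_inv_cancel two_ne_zero ENNReal.ofNat_ne_top]
    _ ≤ ∑' a, (ENNReal.ofReal √((p a).toReal * (q a).toReal) +
          ENNReal.ofReal (δ ^ 2 / 2) * p a) := by
        refine ENNReal.tsum_le_tsum fun a => ?_
        have : (p a + q a) / 2 = ENNReal.ofReal (((p a).toReal + (q a).toReal) / 2) := by
          rw [ENNReal.ofReal_div_of_pos two_pos, ENNReal.ofReal_add (by positivity) (by positivity),
            ENNReal.ofReal_toReal (p.apply_ne_top a), ENNReal.ofReal_toReal (q.apply_ne_top a)]
          simp
        rw [this, ← ENNReal.ofReal_toReal (p.apply_ne_top a), ENNReal.toReal_ofReal (by positivity),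
          ← ENNReal.ofReal_mul (by positivity), ← ENNReal.ofReal_add (by positivity) (by positivity)]
        exact ENNReal.ofReal_le_ofReal
          (half_add_le_sqrt_mul_add (by positivity) (by positivity) (h a))
    _ = affinity p q + ENNReal.ofReal (δ ^ 2 / 2) := by
        rw [ENNReal.tsum_add, ENNReal.tsum_mul_left, p.tsum_coe, mul_one, affinity]

theorem PMF.summable_toReal {A : Type*} (p : PMF A) : Summable fun a => (p a).toReal :=
  ENNReal.summable_toReal p.tsum_coe_ne_top

theorem PMF.tsum_toReal {A : Type*} (p : PMF A) : ∑' a, (p a).toReal = 1 := by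
  rw [← ENNReal.tsum_toReal_eq fun a => p.apply_ne_top a, p.tsum_coe, ENNReal.toReal_one]

/-- A form of the Hellinger bound on `ℓ¹` that is linear in the affinity, so it can be summed
termwise without Cauchy–Schwarz. In `√a`, `√b` it is a quadratic form, nearly degenerate at the
ratio `50 : 41`. -/
theorem abs_sub_add_sqrt_le {a b : ℝ} (ha : 0 ≤ a) (hb : 0 ≤ b) :
    |a - b| + 10 * √(a * b) ≤ 51 / 10 * (a + b) := by
  rw [Real.sqrt_mul ha]
  have hA := Real.sq_sqrt ha
  have hB := Real.sq_sqrt hb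
  set s := √a
  set r := √b
  rw [← hA, ← hB, ← le_sub_iff_add_le, abs_le]
  constructor <;> nlinarith [sq_nonneg (41 * s - 50 * r), sq_nonneg (50 * s - 41 * r), sq_nonneg s,
    sq_nonneg r]

/-- If the affinity is at least `1 - η`, the `ℓ¹` distance is at most `1 / 5 + 10 η`. -/
theorem tsum_abs_sub_le {A : Type*} (p q : PMF A) {η : ℝ} (hη : 0 ≤ η)
    (h : 1 ≤ affinity p q + ENNReal.ofReal η) :
    ∑' a, |(p a).toReal - (q a).toReal| ≤ 1 / 5 + 10 * η := by
  have hp := PMF.summable_toReal p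
  have hq := PMF.summable_toReal q
  have htop : affinity p q ≠ ⊤ := ne_top_of_le_ne_top ENNReal.one_ne_top (affinity_le_one p q)
  have hs : Summable fun a => √((p a).toReal * (q a).toReal) := by
    have := ENNReal.summable_toReal htop
    simpa [ENNReal.toReal_ofReal] using this
  have hB : (affinity p q).toReal = ∑' a, √((p a).toReal * (q a).toReal) := by
    rw [affinity, ENNReal.tsum_toReal_eq fun a => ENNReal.ofReal_ne_top]
    simp [ENNReal.toReal_ofReal]
  have h1 : 1 ≤ (affinity p q).toReal + η := by
    have := ENNReal.toReal_mono (by finiteness) h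
    rwa [ENNReal.toReal_add htop ENNReal.ofReal_ne_top, ENNReal.toReal_ofReal hη,
      ENNReal.toReal_one] at this
  have hd : Summable fun a => |(p a).toReal - (q a).toReal| := (hp.sub hq).abs
  have := (hd.add (hs.mul_left 10)).tsum_le_tsum
    (fun a => abs_sub_add_sqrt_le (a := (p a).toReal) (b := (q a).toReal)
      (by positivity) (by positivity)) ((hp.add hq).mul_left (51 / 10))
  rw [hd.tsum_add (hs.mul_left 10), tsum_mul_left, tsum_mul_left, hp.tsum_add hq,
    PMF.tsum_toReal, PMF.tsum_toReal, ← hB] at this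
  linarith

/-! ### Message laws -/

theorem tsum_snoc {Y : Type*} {t : ℕ} (f : (Fin (t + 1) → Y) → ℝ≥0∞) :
    ∑' y, f y = ∑' (h : Fin t → Y) (y : Y), f (Fin.snoc (α := fun _ => Y) h y) := by
  rw [← (Fin.snocEquiv fun _ => Y).tsum_eq, ENNReal.tsum_prod', ENNReal.tsum_comm]
  rfl

namespace InteractiveProtocol

variable {k : ℕ} {Y : Type*} [Countable Y] {𝒲 : Set (Channel k Y)} {n : ℕ} {Ω : Type u}
  [MeasurableSpace Ω]

theorem messageLaw_succ_snoc (P : InteractiveProtocol 𝒲 n Ω) (p : PMF (Fin (2 * k))) (ω : Ω)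
    {t : ℕ} (ht : t + 1 ≤ n) (h : Fin t → Y) (y : Y) :
    P.messageLaw p ω (t + 1) ht (Fin.snoc (α := fun _ => Y) h y) =
      P.messageLaw p ω t (Nat.le_of_succ_le ht) h * (p.bind (P.channel ⟨t, ht⟩ h ω)) y := by
  rw [messageLaw, PMF.bind_apply, tsum_eq_single h]
  · congr 1
    rw [← PMF.bind_bind, PMF.bind_apply, tsum_eq_single y]
    · simp
    · intro y' hy'
      rw [PMF.pure_apply, if_neg, mul_zero]
      intro he
      exact hy' (Fin.snoc_inj.mp he).2.symm
  · intro h' hh'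
    rw [← PMF.bind_bind, PMF.bind_apply]
    convert mul_zero _
    rw [ENNReal.tsum_eq_zero]
    intro y'
    rw [PMF.pure_apply, if_neg, mul_zero]
    intro he
    exact hh' (Fin.snoc_inj.mp he).1.symm

theorem measurable_messageLaw (P : InteractiveProtocol 𝒲 n Ω) (p : PMF (Fin (2 * k))) :
    ∀ (t : ℕ) (ht : t ≤ n) (y : Fin t → Y), Measurable fun ω => P.messageLaw p ω t ht y := by
  intro t
  induction t with
  | zero => intro ht y; simp only [messageLaw]; exact measurable_const
  | succ t ih =>
    intro ht y
    rw [← Fin.snoc_init_self y]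
    simp_rw [messageLaw_succ_snoc, PMF.bind_apply]
    exact (ih _ _).mul (Measurable.tsum fun x =>
      (P.measurable_channel _ _ _ _).const_mul _)

theorem measurable_error (P : InteractiveProtocol 𝒲 n Ω)
    (est : (Fin n → Y) → Ω → PMF (Fin (2 * k))) (hest : ∀ y x, Measurable fun ω => est y ω x)
    (ε : ℝ) (p : PMF (Fin (2 * k))) :
    Measurable fun ω =>
      (P.messageLaw p ω n le_rfl).toOuterMeasure {y | ε < tvDist (est y ω) p} := by
  classical
  simp_rw [PMF.toOuterMeasure_apply]
  refine Measurable.tsum fun y => ?_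
  have hm : MeasurableSet {ω | ε < tvDist (est y ω) p} := by
    refine measurableSet_lt measurable_const (Measurable.iSup fun S => ?_)
    exact Finset.measurable_sum _ fun x _ => (hest y x).ennreal_toReal.sub measurable_const
  exact (P.measurable_messageLaw p n le_rfl y).indicator hm

/-- Given the history, both laws use the same channel, so each new message multiplies the history's
term by a one-step affinity that is at least `1 - δ²/2`. The history terms sum to at most `1`, so
the losses add. -/
theorem one_le_affinity_messageLaw_add (P : InteractiveProtocol 𝒲 n Ω) (p q : PMF (Fin (2 * k)))
    (ω : Ω) (δ : ℝ)
    (h : ∀ W ∈ 𝒲, ∀ y, |((p.bind W) y).toReal - ((q.bind W) y).toReal| ≤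
      δ * ((p.bind W) y).toReal) :
    ∀ (t : ℕ) (ht : t ≤ n), 1 ≤ affinity (P.messageLaw p ω t ht) (P.messageLaw q ω t ht) +
      t * ENNReal.ofReal (δ ^ 2 / 2) := by
  intro t
  induction t with
  | zero =>
    intro ht
    simp only [messageLaw, affinity]
    rw [tsum_eq_single Fin.elim0 fun b hb => (hb (Subsingleton.elim _ _)).elim]
    simp
  | succ t ih =>
    intro ht
    have ht' := Nat.le_of_succ_le ht
    set s : (Fin t → Y) → ℝ≥0∞ := fun g =>
      ENNReal.ofReal √((P.messageLaw p ω t ht' g).toReal * (P.messageLaw q ω t ht' g).toReal)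
    have hs : affinity (P.messageLaw p ω t ht') (P.messageLaw q ω t ht') = ∑' g, s g := rfl
    have hrec : affinity (P.messageLaw p ω (t + 1) ht) (P.messageLaw q ω (t + 1) ht) =
        ∑' g, s g * affinity (p.bind (P.channel ⟨t, ht⟩ g ω)) (q.bind (P.channel ⟨t, ht⟩ g ω)) := by
      rw [affinity, tsum_snoc]
      refine tsum_congr fun g => ?_
      rw [affinity, ← ENNReal.tsum_mul_left]
      refine tsum_congr fun y => ?_
      simp only [s]
      rw [messageLaw_succ_snoc, messageLaw_succ_snoc, ENNReal.toReal_mul, ENNReal.toReal_mul,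
        mul_mul_mul_comm, Real.sqrt_mul (by positivity), ENNReal.ofReal_mul (by positivity)]
    calc (1 : ℝ≥0∞) ≤ ∑' g, s g + t * ENNReal.ofReal (δ ^ 2 / 2) := hs ▸ ih ht'
      _ ≤ ∑' g, s g * (affinity (p.bind (P.channel ⟨t, ht⟩ g ω))
            (q.bind (P.channel ⟨t, ht⟩ g ω)) + ENNReal.ofReal (δ ^ 2 / 2)) +
            t * ENNReal.ofReal (δ ^ 2 / 2) := by
          gcongr with g
          exact le_mul_of_one_le_right' (one_le_affinity_add _ _ δ (h _ (P.channel_mem _ _ _)))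
      _ = ∑' g, s g * affinity (p.bind (P.channel ⟨t, ht⟩ g ω))
            (q.bind (P.channel ⟨t, ht⟩ g ω)) + (∑' g, s g) * ENNReal.ofReal (δ ^ 2 / 2) +
            t * ENNReal.ofReal (δ ^ 2 / 2) := by
          simp_rw [mul_add]
          rw [ENNReal.tsum_add, ENNReal.tsum_mul_right]
      _ ≤ ∑' g, s g * affinity (p.bind (P.channel ⟨t, ht⟩ g ω))
            (q.bind (P.channel ⟨t, ht⟩ g ω)) + 1 * ENNReal.ofReal (δ ^ 2 / 2) +
            t * ENNReal.ofReal (δ ^ 2 / 2) := by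
          gcongr
          exact hs ▸ affinity_le_one _ _
      _ = _ := by
          rw [hrec]; push_cast; ring

end InteractiveProtocol

/-! ### Contraction under private channels -/

theorem PMF.toReal_bind_apply {X A : Type*} [Fintype X] (p : PMF X) (W : X → PMF A) (a : A) :
    ((p.bind W) a).toReal = ∑ x, (p x).toReal * (W x a).toReal := by
  rw [PMF.bind_apply, tsum_fintype,
    ENNReal.toReal_sum fun x _ => ENNReal.mul_ne_top (p.apply_ne_top x) ((W x).apply_ne_top a)]
  simp

theorem abs_bind_sub_bind_le {k : ℕ} {ρ : ℝ} (hρ : 0 < ρ) (hρ1 : ρ ≤ 1)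
    {W : Channel k (List Bool)} (hW : W ∈ ldpChannels k ρ) (p q : PMF (Fin (2 * k)))
    (y : List Bool) :
    |((p.bind W) y).toReal - ((q.bind W) y).toReal| ≤
      (∑ x, |(p x).toReal - (q x).toReal|) * (2 * ρ) * ((p.bind W) y).toReal := by
  have hexp : Real.exp ρ - 1 ≤ 2 * ρ := by
    have := Real.abs_exp_sub_one_le (x := ρ) (by rwa [abs_of_pos hρ])
    rw [abs_of_pos hρ] at this
    exact (le_abs_self _).trans this
  have hsum (r : PMF (Fin (2 * k))) : ∑ x, (r x).toReal = 1 := by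
    rw [← PMF.tsum_toReal r, tsum_fintype]
  set w : Fin (2 * k) → ℝ := fun x => (W x y).toReal with hw
  have hw0 (x) : 0 ≤ w x := ENNReal.toReal_nonneg
  have hratio (x x') : w x ≤ Real.exp ρ * w x' := by
    have := ENNReal.toReal_mono
      (ENNReal.mul_ne_top ENNReal.ofReal_ne_top ((W x').apply_ne_top y)) (hW x x' y)
    rwa [ENNReal.toReal_mul, ENNReal.toReal_ofReal (Real.exp_pos ρ).le] at this
  -- The reference point `x''` is free, so averaging it over `p` turns `w x''` into the output
  -- probability `a`.
  have hdiff (x x' x'') : w x - w x' ≤ 2 * ρ * w x'' := by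
    have h1 := hratio x x'
    have h2 := hratio x x''
    have hE : 0 < Real.exp ρ := Real.exp_pos ρ
    have hE1 : 0 ≤ Real.exp ρ - 1 := by linarith [Real.add_one_le_exp ρ]
    have h3 : Real.exp ρ * (w x - w x') ≤ Real.exp ρ * ((Real.exp ρ - 1) * w x'') := by
      nlinarith [mul_le_mul_of_nonneg_left h2 hE1]
    exact (le_of_mul_le_mul_left h3 hE).trans (mul_le_mul_of_nonneg_right hexp (hw0 _))
  set a := ((p.bind W) y).toReal with ha
  have ha' : a = ∑ x, (p x).toReal * w x := PMF.toReal_bind_apply p W y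
  have hdiffa (x x') : |w x - w x'| ≤ 2 * ρ * a := by
    have key (x x') : w x - w x' ≤ 2 * ρ * a := by
      calc w x - w x' = ∑ x'', (p x'').toReal * (w x - w x') := by
            rw [← Finset.sum_mul, hsum, one_mul]
        _ ≤ ∑ x'', (p x'').toReal * (2 * ρ * w x'') :=
            Finset.sum_le_sum fun x'' _ => by gcongr; exact hdiff _ _ _
        _ = 2 * ρ * a := by
            rw [ha', Finset.mul_sum]
            exact Finset.sum_congr rfl fun _ _ => by ring
    rw [abs_le]
    exact ⟨by linarith [key x' x], key x x'⟩
  obtain ⟨x₀, -⟩ := p.support_nonempty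
  rw [ha', PMF.toReal_bind_apply q W y]
  -- Both laws have mass one, so `w` may be centred at `x₀`; only its oscillation matters.
  calc |∑ x, (p x).toReal * w x - ∑ x, (q x).toReal * w x|
      = |∑ x, ((p x).toReal - (q x).toReal) * (w x - w x₀)| := by
        congr 1
        simp_rw [mul_sub, sub_mul]
        simp only [Finset.sum_sub_distrib, ← Finset.sum_mul, hsum]
        ring
    _ ≤ ∑ x, |((p x).toReal - (q x).toReal) * (w x - w x₀)| := Finset.abs_sum_le_sum_abs _ _
    _ ≤ ∑ x, |(p x).toReal - (q x).toReal| * (2 * ρ * a) :=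
        Finset.sum_le_sum fun x _ => by rw [abs_mul]; gcongr; exact hdiffa _ _
    _ = _ := by rw [← Finset.sum_mul, ← ha']; ring

/-! ### The perturbed uniform distributions -/

/-- The sign of a bit. -/
def bitSign (b : Bool) : ℝ := if b then 1 else -1

theorem abs_bitSign (b : Bool) : |bitSign b| = 1 := by cases b <;> simp [bitSign]

theorem bitSign_not (b : Bool) : bitSign (!b) = -bitSign b := by cases b <;> simp [bitSign]

/-- The domain `[2k]` as `k` pairs of points. -/
def pairEquiv (k : ℕ) : Bool × Fin k ≃ Fin (2 * k) :=
  (finTwoEquiv.symm.prodCongr (Equiv.refl _)).trans finProdFinEquiv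

theorem sum_pairEquiv {k : ℕ} {M : Type*} [AddCommMonoid M] (f : Fin (2 * k) → M) :
    ∑ x, f x = ∑ i, (f (pairEquiv k (true, i)) + f (pairEquiv k (false, i))) := by
  rw [← (pairEquiv k).sum_comp, Fintype.sum_prod_type_right]
  simp

/-- The mass that the distribution with signs `z` gives to the point `b` of the pair `i`. -/
noncomputable def perturbedMass {k : ℕ} (γ : ℝ) (z : Fin k → Bool) (x : Bool × Fin k) : ℝ :=
  (1 + γ * (bitSign x.1 * bitSign (z x.2))) / (2 * k)

theorem perturbedMass_nonneg {k : ℕ} {γ : ℝ} (hγ : 0 ≤ γ) (hγ1 : γ ≤ 1) (z : Fin k → Bool)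
    (x : Bool × Fin k) : 0 ≤ perturbedMass γ z x := by
  refine div_nonneg ?_ (by positivity)
  cases x.1 <;> cases z x.2 <;> simp [bitSign] <;> linarith

/-- The uniform distribution on `[2k]`, with the two points of each pair `i` perturbed by
`± γ / (2k)` according to the sign `z i`. -/
noncomputable def perturbed {k : ℕ} (hk : 1 ≤ k) {γ : ℝ} (hγ : 0 ≤ γ) (hγ1 : γ ≤ 1)
    (z : Fin k → Bool) : PMF (Fin (2 * k)) :=
  PMF.ofFintype (fun x => ENNReal.ofReal (perturbedMass γ z ((pairEquiv k).symm x))) (by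
    have hk' : (k : ℝ) ≠ 0 := by positivity
    rw [← ENNReal.ofReal_sum_of_nonneg fun x _ => perturbedMass_nonneg hγ hγ1 z _, sum_pairEquiv]
    simp only [Equiv.symm_apply_apply, perturbedMass, bitSign]
    rw [Finset.sum_congr rfl fun i _ => show _ = 1 / (k : ℝ) by
      cases z i <;> simp <;> field_simp <;> ring]
    simp [hk'])

theorem perturbed_apply {k : ℕ} (hk : 1 ≤ k) {γ : ℝ} (hγ : 0 ≤ γ) (hγ1 : γ ≤ 1)
    (z : Fin k → Bool) (x : Bool × Fin k) :
    (perturbed hk hγ hγ1 z (pairEquiv k x)).toReal = perturbedMass γ z x := by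
  rw [perturbed, PMF.ofFintype_apply, Equiv.symm_apply_apply,
    ENNReal.toReal_ofReal (perturbedMass_nonneg hγ hγ1 z x)]

/-- Negate the `i`-th sign. -/
def flipSign {k : ℕ} (i : Fin k) (z : Fin k → Bool) : Fin k → Bool := Function.update z i (!z i)

theorem flipSign_involutive {k : ℕ} (i : Fin k) : Function.Involutive (flipSign i) := by
  intro z; simp [flipSign]

theorem sum_abs_perturbed_sub_flipSign {k : ℕ} (hk : 1 ≤ k) {γ : ℝ} (hγ : 0 ≤ γ) (hγ1 : γ ≤ 1)
    (z : Fin k → Bool) (i : Fin k) :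
    ∑ x, |(perturbed hk hγ hγ1 z x).toReal - (perturbed hk hγ hγ1 (flipSign i z) x).toReal| =
      2 * γ / k := by
  have hk' : (0 : ℝ) < k := by exact_mod_cast hk
  simp only [sum_pairEquiv, perturbed_apply]
  rw [Finset.sum_eq_single i]
  · have (b : Bool) : |perturbedMass γ z (b, i) - perturbedMass γ (flipSign i z) (b, i)| =
        γ / k := by
      have : perturbedMass γ z (b, i) - perturbedMass γ (flipSign i z) (b, i) =
          γ / k * (bitSign b * bitSign (z i)) := by
        simp only [perturbedMass, flipSign, Function.update_self, bitSign_not]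
        field_simp
        ring
      rw [this, abs_mul, abs_mul, abs_bitSign, abs_bitSign, abs_of_nonneg (by positivity)]
      ring
    rw [this, this]
    ring
  · intro j _ hj
    simp [perturbedMass, flipSign, Function.update_of_ne hj]
  · simp

/-- Restriction of a mass to the interval between the two masses of a perturbed pair. -/
noncomputable def clipMass (k : ℕ) (γ t : ℝ) : ℝ :=
  max ((1 - γ) / (2 * k)) (min ((1 + γ) / (2 * k)) t)

/-- The estimate of the `i`-th sign, in `[-1, 1]`, given by a distribution on `[2k]`. -/
noncomputable def signEstimate {k : ℕ} (γ : ℝ) (q : PMF (Fin (2 * k))) (i : Fin k) : ℝ :=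
  (clipMass k γ (q (pairEquiv k (true, i))).toReal -
    clipMass k γ (q (pairEquiv k (false, i))).toReal) * (k / γ)

theorem clipMass_bounds {k : ℕ} {γ : ℝ} (hγ : 0 ≤ γ) (t : ℝ) :
    (1 - γ) / (2 * k) ≤ clipMass k γ t ∧ clipMass k γ t ≤ (1 + γ) / (2 * k) := by
  refine ⟨le_max_left _ _, max_le ?_ (min_le_left _ _)⟩
  gcongr
  linarith

theorem abs_signEstimate_le {k : ℕ} (hk : 1 ≤ k) {γ : ℝ} (hγ : 0 < γ) (q : PMF (Fin (2 * k)))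
    (i : Fin k) : |signEstimate γ q i| ≤ 1 := by
  have hk' : (0 : ℝ) < k := by exact_mod_cast hk
  rw [signEstimate, abs_mul, abs_of_pos (div_pos hk' hγ), ← le_div_iff₀ (div_pos hk' hγ),
    one_div_div]
  obtain ⟨h1, h2⟩ := clipMass_bounds (k := k) hγ.le (q (pairEquiv k (true, i))).toReal
  obtain ⟨h3, h4⟩ := clipMass_bounds (k := k) hγ.le (q (pairEquiv k (false, i))).toReal
  have : γ / k = (1 + γ) / (2 * k) - (1 - γ) / (2 * k) := by field_simp; ring
  rw [this, abs_le]
  constructor <;> linarith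

theorem sub_clipMass_le {k : ℕ} (γ t : ℝ) :
    (1 + γ) / (2 * k) - clipMass k γ t ≤ |t - (1 + γ) / (2 * k)| := by
  have h := le_max_right ((1 - γ) / (2 * k)) (min ((1 + γ) / (2 * k)) t)
  rw [← clipMass] at h
  rcases min_choice ((1 + γ) / (2 * (k : ℝ))) t with h' | h' <;> rw [h'] at h
  · linarith [abs_nonneg (t - (1 + γ) / (2 * k))]
  · linarith [neg_abs_le (t - (1 + γ) / (2 * k))]

theorem clipMass_sub_le {k : ℕ} (γ t : ℝ) :
    clipMass k γ t - (1 - γ) / (2 * k) ≤ |t - (1 - γ) / (2 * k)| := by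
  rw [sub_le_iff_le_add, clipMass]
  refine max_le (by linarith [abs_nonneg (t - (1 - γ) / (2 * k))]) ?_
  linarith [min_le_right ((1 + γ) / (2 * (k : ℝ))) t, le_abs_self (t - (1 - γ) / (2 * k))]

/-- The true masses are endpoints of the clipping interval, so clipping never increases the error.
On each pair the `ℓ¹` error is at least `γ/k` times one minus the sign correlation; the total is at
most `γ/2`. -/
theorem half_le_sum_signEstimate {k : ℕ} (hk : 1 ≤ k) {γ : ℝ} (hγ : 0 < γ) (hγ1 : γ ≤ 1)
    (z : Fin k → Bool) (q : PMF (Fin (2 * k)))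
    (h : tvDist q (perturbed hk hγ.le hγ1 z) ≤ γ / 4) :
    (k : ℝ) / 2 ≤ ∑ i, bitSign (z i) * signEstimate γ q i := by
  have hk' : (0 : ℝ) < k := by exact_mod_cast hk
  have h1 := (half_sum_abs_sub_le_tvDist q (perturbed hk hγ.le hγ1 z)).trans h
  simp only [sum_pairEquiv, perturbed_apply] at h1
  have h2 (i : Fin k) : γ / k - γ / k * (bitSign (z i) * signEstimate γ q i) ≤
      |(q (pairEquiv k (true, i))).toReal - perturbedMass γ z (true, i)| +
        |(q (pairEquiv k (false, i))).toReal - perturbedMass γ z (false, i)| := by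
    have h3 : γ / k * (bitSign (z i) * signEstimate γ q i) = bitSign (z i) *
        (clipMass k γ (q (pairEquiv k (true, i))).toReal -
          clipMass k γ (q (pairEquiv k (false, i))).toReal) := by
      rw [signEstimate]; field_simp
    have h4 : γ / k = (1 + γ) / (2 * k) - (1 - γ) / (2 * k) := by field_simp; ring
    rw [h3, h4]
    cases hz : z i
    · have h5 := clipMass_sub_le (k := k) γ (q (pairEquiv k (true, i))).toReal
      have h6 := sub_clipMass_le (k := k) γ (q (pairEquiv k (false, i))).toReal
      simp only [perturbedMass, bitSign, hz] at *
      norm_num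
      rw [← sub_eq_add_neg]
      linarith
    · have h5 := sub_clipMass_le (k := k) γ (q (pairEquiv k (true, i))).toReal
      have h6 := clipMass_sub_le (k := k) γ (q (pairEquiv k (false, i))).toReal
      simp only [perturbedMass, bitSign, hz] at *
      norm_num
      rw [← sub_eq_add_neg]
      linarith
  have h3 := Finset.sum_le_sum fun i (_ : i ∈ Finset.univ) => h2 i
  rw [Finset.sum_sub_distrib, ← Finset.mul_sum, Finset.sum_const, Finset.card_univ,
    Fintype.card_fin, nsmul_eq_mul, mul_div_cancel₀ _ hk'.ne'] at h3
  set T := ∑ i, bitSign (z i) * signEstimate γ q i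
  have h4 : γ / 2 ≤ γ / k * T := by linarith
  rw [div_mul_eq_mul_div, le_div_iff₀ hk'] at h4
  refine le_of_mul_le_mul_left ?_ hγ
  linarith

/-! ### Averaging over the signs -/

theorem summable_toReal_mul {A : Type*} (p : PMF A) {f : A → ℝ} {C : ℝ} (hf : ∀ a, |f a| ≤ C) :
    Summable fun a => (p a).toReal * f a := by
  refine Summable.of_norm_bounded ((PMF.summable_toReal p).mul_right C) fun a => ?_
  rw [Real.norm_eq_abs, abs_mul, abs_of_nonneg ENNReal.toReal_nonneg]
  gcongr
  exact hf a

/-- If sign estimates correlate with the true signs outside small error events, then two of the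
laws that differ in one sign are far apart. -/
theorem le_of_signs_estimated {k : ℕ} (hk : 1 ≤ k) {A : Type*} (P : (Fin k → Bool) → PMF A)
    (φ : Fin k → A → ℝ) (hφ : ∀ i a, |φ i a| ≤ 1) (E : (Fin k → Bool) → Set A)
    (hE : ∀ z, ∀ a ∉ E z, (k : ℝ) / 2 ≤ ∑ i, bitSign (z i) * φ i a)
    (herr : ∑ z, (P z).toOuterMeasure (E z) ≤ 2 ^ k * (1 / 100)) {D : ℝ}
    (hD : ∀ z i, ∑' a, |(P z a).toReal - (P (flipSign i z) a).toReal| ≤ D) :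
    97 / 100 ≤ D := by
  classical
  have hk' : (0 : ℝ) < k := by exact_mod_cast hk
  set V : (Fin k → Bool) → Fin k → ℝ := fun z i => ∑' a, (P z a).toReal * φ i a
  have hsum (z i) : Summable fun a => (P z a).toReal * φ i a := summable_toReal_mul _ (hφ i)
  -- The correlation is at least `k/2` off `E z` and at least `-k` on it, a deficit of `3k/2`.
  have hlower (z) : (k : ℝ) / 2 - 3 / 2 * k * ((P z).toOuterMeasure (E z)).toReal ≤
      ∑ i, bitSign (z i) * V z i := by
    have hS (a) : |∑ i, bitSign (z i) * φ i a| ≤ k := by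
      calc |∑ i, bitSign (z i) * φ i a| ≤ ∑ i, |bitSign (z i) * φ i a| :=
            Finset.abs_sum_le_sum_abs _ _
        _ ≤ ∑ _i : Fin k, (1 : ℝ) :=
            Finset.sum_le_sum fun i _ => by rw [abs_mul, abs_bitSign, one_mul]; exact hφ i a
        _ = k := by simp
    have hind : Summable fun a => ((E z).indicator (P z) a).toReal := by
      refine ENNReal.summable_toReal (ne_top_of_le_ne_top (P z).tsum_coe_ne_top ?_)
      exact ENNReal.tsum_le_tsum fun a => Set.indicator_le_self _ _ a
    have h1 : ∑ i, bitSign (z i) * V z i =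
        ∑' a, (P z a).toReal * ∑ i, bitSign (z i) * φ i a := by
      simp only [V, ← tsum_mul_left]
      rw [← Summable.tsum_finsetSum fun i _ => (hsum z i).mul_left _]
      refine tsum_congr fun a => ?_
      rw [Finset.mul_sum]
      exact Finset.sum_congr rfl fun i _ => by ring
    have h2 : ((P z).toOuterMeasure (E z)).toReal = ∑' a, ((E z).indicator (P z) a).toReal := by
      rw [PMF.toOuterMeasure_apply, ENNReal.tsum_toReal_eq]
      exact fun a => ne_top_of_le_ne_top ((P z).apply_ne_top a) (Set.indicator_le_self _ _ a)
    have h3 : (k : ℝ) / 2 = ∑' a, (P z a).toReal * (k / 2) := by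
      rw [tsum_mul_right, PMF.tsum_toReal, one_mul]
    rw [h1, h2, ← tsum_mul_left, h3,
      ← ((PMF.summable_toReal (P z)).mul_right _).tsum_sub (hind.mul_left _)]
    refine (((PMF.summable_toReal (P z)).mul_right _).sub (hind.mul_left _)).tsum_le_tsum
      (fun a => ?_) (summable_toReal_mul _ hS)
    have hp : 0 ≤ (P z a).toReal := ENNReal.toReal_nonneg
    by_cases ha : a ∈ E z
    · rw [Set.indicator_of_mem ha]
      nlinarith [mul_le_mul_of_nonneg_left (abs_le.mp (hS a)).1 hp]
    · rw [Set.indicator_of_notMem ha]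
      simpa using mul_le_mul_of_nonneg_left (hE z a ha) hp
  have hupper (i) : ∑ z, bitSign (z i) * V z i ≤ 2 ^ k * (D / 2) := by
    -- The sign is odd under the flip, so twice the sum only sees differences between neighbouring
    -- laws.
    have hflip : ∑ z, bitSign (z i) * V z i = ∑ z, -(bitSign (z i) * V (flipSign i z) i) := by
      rw [← Equiv.sum_comp (flipSign_involutive i).toPerm]
      refine Finset.sum_congr rfl fun z _ => ?_
      simp [flipSign, bitSign_not]
    have hterm (z) : bitSign (z i) * V z i - bitSign (z i) * V (flipSign i z) i ≤ D := by
      have hd : Summable fun a => |(P z a).toReal - (P (flipSign i z) a).toReal| :=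
        ((PMF.summable_toReal _).sub (PMF.summable_toReal _)).abs
      refine le_trans ?_ (hD z i)
      rw [← mul_sub]
      simp only [V]
      rw [← (hsum z i).tsum_sub (hsum _ i), ← tsum_mul_left]
      refine (((hsum z i).sub (hsum _ i)).mul_left _).tsum_le_tsum (fun a => ?_) hd
      rw [← sub_mul]
      refine (le_abs_self _).trans ?_
      rw [abs_mul, abs_bitSign, one_mul, abs_mul]
      exact mul_le_of_le_one_right (abs_nonneg _) (hφ i a)
    have h2 : 2 * ∑ z, bitSign (z i) * V z i ≤ ∑ _z : Fin k → Bool, D := by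
      rw [two_mul]
      nth_rw 2 [hflip]
      rw [← Finset.sum_add_distrib]
      exact Finset.sum_le_sum fun z _ => by linarith [hterm z]
    rw [Finset.sum_const, Finset.card_univ, Fintype.card_fun, Fintype.card_bool, Fintype.card_fin,
      nsmul_eq_mul] at h2
    push_cast at h2
    linarith
  have herr' : ∑ z, ((P z).toOuterMeasure (E z)).toReal ≤ 2 ^ k * (1 / 100) := by
    have hfin : (2 ^ k * (1 / 100) : ℝ≥0∞) ≠ ⊤ := by finiteness
    have := ENNReal.toReal_mono hfin herr
    rw [ENNReal.toReal_sum fun z _ => ne_top_of_le_ne_top hfin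
      ((Finset.single_le_sum (fun _ _ => zero_le) (Finset.mem_univ z)).trans herr)] at this
    simpa using this
  have h1 := Finset.sum_le_sum fun z (_ : z ∈ Finset.univ) => hlower z
  rw [Finset.sum_sub_distrib, Finset.sum_const, Finset.card_univ, Fintype.card_fun,
    Fintype.card_bool, Fintype.card_fin, nsmul_eq_mul, ← Finset.mul_sum, Finset.sum_comm] at h1
  have h2 := Finset.sum_le_sum fun i (_ : i ∈ Finset.univ) => hupper i
  rw [Finset.sum_const, Finset.card_univ, Fintype.card_fin, nsmul_eq_mul] at h2
  push_cast at h1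
  have h3 := mul_le_mul_of_nonneg_left herr' (show (0 : ℝ) ≤ 3 / 2 * k by positivity)
  have h4 : (k : ℝ) * 2 ^ k * (97 / 100) ≤ (k : ℝ) * 2 ^ k * D := by linarith
  exact le_of_mul_le_mul_left h4 (by positivity)

/-! ### The lower bound -/

theorem le_of_hasEstimator {k n : ℕ} {ε ρ : ℝ} (hk : 1 ≤ k) (hε : 0 < ε) (hε1 : ε ≤ 1 / 4)
    (hρ : 0 < ρ) (hρ1 : ρ ≤ 1) (h : HasEstimator.{u} (ldpChannels k ρ) ε n) :
    1 / 2000 * ((k : ℝ) ^ 2 / (ε ^ 2 * ρ ^ 2)) ≤ n := by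
  obtain ⟨Ω, _, μ, _, P, est, hest, herr⟩ := h
  have hk' : (0 : ℝ) < k := by exact_mod_cast hk
  set γ : ℝ := 4 * ε with hγdef
  have hγ : 0 < γ := by positivity
  have hγ1 : γ ≤ 1 := by linarith
  set p := perturbed hk hγ.le hγ1
  have hmeas (z) := P.measurable_error est hest ε (p z)
  -- Some value of the public randomness does no worse than average for the total error over all
  -- `z`, so it can be fixed.
  obtain ⟨ω, hω⟩ := exists_le_lintegral (μ := μ)
    (Finset.measurable_sum Finset.univ fun z _ => hmeas z).aemeasurable
  rw [lintegral_finsetSum _ fun z _ => hmeas z] at hω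
  have hω' := hω.trans (Finset.sum_le_sum fun z _ => (le_iSup _ (p z)).trans herr)
  rw [Finset.sum_const, Finset.card_univ, Fintype.card_fun, Fintype.card_bool, Fintype.card_fin,
    nsmul_eq_mul] at hω'
  push_cast at hω'
  set δ : ℝ := 2 * γ / k * (2 * ρ) with hδ
  have hD (z i) : ∑' y, |(P.messageLaw (p z) ω n le_rfl y).toReal -
      (P.messageLaw (p (flipSign i z)) ω n le_rfl y).toReal| ≤ 1 / 5 + 10 * (n * (δ ^ 2 / 2)) := by
    refine tsum_abs_sub_le _ _ (by positivity) ?_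
    rw [ENNReal.ofReal_mul (by positivity), ENNReal.ofReal_natCast]
    refine P.one_le_affinity_messageLaw_add _ _ ω δ (fun W hW y => ?_) n le_rfl
    rw [hδ, ← sum_abs_perturbed_sub_flipSign hk hγ.le hγ1 z i]
    exact abs_bind_sub_bind_le hρ hρ1 hW _ _ y
  have key := le_of_signs_estimated hk (fun z => P.messageLaw (p z) ω n le_rfl)
    (fun i y => signEstimate γ (est y ω) i) (fun i y => abs_signEstimate_le hk hγ _ i)
    (fun z => {y | ε < tvDist (est y ω) (p z)})
    (fun z y hy => half_le_sum_signEstimate hk hγ hγ1 z _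
      ((not_lt.mp hy).trans (by linarith))) (by simpa using hω') hD
  have hδ' : δ ^ 2 = 256 * (ε ^ 2 * ρ ^ 2) / k ^ 2 := by rw [hδ, hγdef]; field_simp; ring
  rw [hδ'] at key
  have hpos : 0 < ε ^ 2 * ρ ^ 2 := by positivity
  rw [← mul_div_assoc, div_le_iff₀ hpos]
  -- Here `77/100 = 97/100 - 1/5` and `1280 = 10 * 256 / 2`; the constant `1/2000` is below
  -- `0.77/1280`.
  have h1 : 77 / 100 ≤ 1280 * (n * (ε ^ 2 * ρ ^ 2)) / (k : ℝ) ^ 2 := by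
    calc (77 / 100 : ℝ) ≤ 10 * (n * (256 * (ε ^ 2 * ρ ^ 2) / k ^ 2 / 2)) := by linarith
      _ = _ := by ring
  rw [le_div_iff₀ (by positivity)] at h1
  nlinarith [sq_nonneg (k : ℝ)]

end LocalInference

theorem mainTheorem8 :
    ∃ c : ℝ, 0 < c ∧
      ∀ (k : ℕ) (ε ρ : ℝ), 1 ≤ k → 0 < ε → ε ≤ 1 / 4 → 0 < ρ → ρ ≤ 1 →
        ENNReal.ofReal (c * ((k : ℝ) ^ 2 / (ε ^ 2 * ρ ^ 2))) ≤
          ((LocalInference.learningSampleComplexity.{u}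
            (LocalInference.ldpChannels k ρ) ε : ℕ∞) : ℝ≥0∞) := by
  refine ⟨1 / 2000, by norm_num, fun k ε ρ hk hε hε1 hρ hρ1 => ?_⟩
  set r : ℝ := 1 / 2000 * ((k : ℝ) ^ 2 / (ε ^ 2 * ρ ^ 2))
  -- The infimum lives in `ℕ∞`, so the real bound is rounded up; an empty infimum is `⊤` and needs
  -- no separate case.
  have h : ((⌈r⌉₊ : ℕ) : ℕ∞) ≤ LocalInference.learningSampleComplexity.{u}
      (LocalInference.ldpChannels k ρ) ε :=
    le_iInf₂ fun n hn => 
      Nat.cast_le.mpr (Nat.ceil_le.mpr (LocalInference.le_of_hasEstimator hk hε hε1 hρ hρ1 hn))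
  refine le_trans ?_ (ENat.toENNReal_le.mpr h)
  rw [ENat.toENNReal_coe, ← ENNReal.ofReal_natCast]
  exact ENNReal.ofReal_le_ofReal (Nat.le_ceil r)
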